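/- For $x>0$ and $q>0$, $q\neq 1$, let $\Gamma_q$ be the $q$-gamma function, $$\Gamma_q(x)=(1-q)^{1-x}\prod_{k=0}^{\infty}\frac{1-q^{k+1}}{1-q^{k+x}}\quad(0<q<1),\qquad \Gamma_q(x)=(q-1)^{1-x}q^{\frac12 x(x-1)}\prod_{k=0}^{\infty}\frac{1-q^{-(k+1)}}{1-q^{-(k+x)}}\quad(q>1),$$ let $\psi_q=\Gamma_q'/\Gamma_q$ be its logarithmic derivative, and let $\psi_q^{(k)}$ be the $k$-th derivative of $\psi_q$, with $\psi_q^{(0)}=\psi_q$. For a function $f$ and $c\neq 0$ put $\Delta f(x;c)=\frac{f(x+c)-f(x)}{c}$. For positive integers $r\ge m\ge n\ge s$ let $$\alpha_{r,m,n,s}=\frac{(m-1)!\,(n-1)!}{(r-1)!\,(s-1)!},$$ $$F_{r,m,n,s}(x;q,c)=(-1)^{m+n}\Delta\psi_q^{(m-1)}(x;c)\,\Delta\psi_q^{(n-1)}(x;c)-\alpha_{r,m,n,s}(-1)^{r+s}\Delta\psi_q^{(r-1)}(x;c)\,\Delta\psi_q^{(s-1)}(x;c).$$ A function $f$ is completely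 monotonic on $(0,\infty)$ if it has derivatives of all orders there and $(-1)^kf^{(k)}(x)\ge 0$ for all $x>0$ and all integers $k\ge 0$. **Theorem.** Let $q>0$, $q\neq 1$ and $0<c<1$ be fixed, and let $r\ge m\ge n\ge s$ be positive integers with $r+s=m+n$. 1. If $s=1$ and $0<q<1$, then $F_{r,m,n,1}(x;q,c)$ is completely monotonic in $x$ on $(0,\infty)$. 2. If $s=2$, then $F_{r,m,n,2}(x;q,c)$ is completely monotonic in $x$ on $(0,\infty)$ (for every $q>0$, $q\ne1$). 3. If $s=3$ and $n=4$, then $F_{r,m,4,3}(x;q,c)$ is completely monotonic in $x$ on $(0,\infty)$ (for every $q>0$, $q\ne1$). -/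

import Mathlib

open Set
open scoped ContDiff Nat

/-- `f` is completely monotonic on `s` (used for open intervals `s`): `f` has derivatives of all
orders on `s`, and `(-1)^k f^{(k)}(x) ≥ 0` for all `x ∈ s` and all `k ≥ 0`. -/
def CompletelyMonotonicOn (f : ℝ → ℝ) (s : Set ℝ) : Prop :=
  ContDiffOn ℝ ∞ f s ∧ ∀ k : ℕ, ∀ x ∈ s, 0 ≤ (-1 : ℝ) ^ k * iteratedDerivWithin k f s x

/-- The `q`-gamma function `Γ_q(x)`, for `x > 0` and `q > 0`, `q ≠ 1`. -/
noncomputable def qGamma (q x : ℝ) : ℝ :=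
  if q < 1 then
    (1 - q) ^ (1 - x) * ∏' n : ℕ, (1 - q ^ (n + 1)) / (1 - q ^ ((n : ℝ) + x))
  else
    (q - 1) ^ (1 - x) * q ^ (x * (x - 1) / 2) *
      ∏' n : ℕ, (1 - (q ^ (n + 1))⁻¹) / (1 - q ^ (-((n : ℝ) + x)))

/-- The `q`-digamma function `ψ_q`, the logarithmic derivative of `Γ_q`. -/
noncomputable def qDigamma (q : ℝ) : ℝ → ℝ :=
  logDeriv (qGamma q)

/-- `qPolygammaPred q k` is `ψ_q^{(k-1)}`: it is `x ↦ -x` for `k = 0` (the convention for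
`ψ_q^{(-1)}`), and the `(k-1)`-st derivative of `ψ_q` for `k ≥ 1`. -/
noncomputable def qPolygammaPred (q : ℝ) : ℕ → ℝ → ℝ
  | 0 => fun x => -x
  | k + 1 => iteratedDeriv k (qDigamma q)

/-- The finite difference `Δf(x;c) = (f(x+c) - f(x)) / c`. -/
noncomputable def finDiff (f : ℝ → ℝ) (x c : ℝ) : ℝ :=
  (f (x + c) - f x) / c

/-- The constant `α_{r,m,n,s} = (m-1)!(n-1)! / ((r-1)!(s-1)!)` for positive integers. For `s = 0`
the truncated subtraction gives `(m-1)!(n-1)! / (r-1)!`, which is the convention for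
`α_{r,m,n,0}`. -/
noncomputable def alphaConst (r m n s : ℕ) : ℝ :=
  (((m - 1)! : ℕ) * ((n - 1)! : ℕ) : ℝ) / (((r - 1)! : ℕ) * ((s - 1)! : ℕ))

/-- The function `F_{r,m,n,s}(x; q, c)`. -/
noncomputable def qF (r m n s : ℕ) (q c x : ℝ) : ℝ :=
  (-1) ^ (m + n) * finDiff (qPolygammaPred q m) x c * finDiff (qPolygammaPred q n) x c -
    alphaConst r m n s * (-1) ^ (r + s) *
      finDiff (qPolygammaPred q r) x c * finDiff (qPolygammaPred q s) x c

/-!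
The differences `(-1) ^ k Δ ψ_q ^ (k)` are exponential series. With `e ^ {-h} = min q q⁻¹`, expanding
the logarithms in the product shows that `log Γ_q(x)` is a quadratic polynomial plus
`∑ j ≥ 1, e ^ {-h j x} / (j (1 - e ^ {-h j}))` (`qGamma_eq_exp`), and the quadratic term is absent
for `q < 1`. So for `q < 1` or `k ≥ 1` the polynomial does not contribute, and
`(-1) ^ k Δ ψ_q ^ (k)(x; c) = (h / c) ∑ j, (h j) ^ k w_j e ^ {-h j x}` with
`w_j = (1 - e ^ {-c h j}) / (1 - e ^ {-h j})` (`finDiff_qPolygammaPred`). By the Cauchy product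
`F_{r,m,n,s}` is an exponential series too, and it is completely monotonic once its coefficients are
nonnegative, that is, once for every `N`
`∑ i + j = N, w_i w_j (i ^ (m-1) j ^ (n-1) - α i ^ (r-1) j ^ (s-1)) ≥ 0` (`weighted_sum_nonneg`).

The weights can be removed. For `0 < c < 1` the sequence `w` is log-concave, because `cosh (c t)` is
a concave function of `cosh t` (`cosh_slope_le`), so that `w_i w_j` decreases in `|i - j|` for fixed
`i + j` (`expWeight_mul_le`). The symmetrised bracket changes its sign at most once, from positive
to negative, as `|i - j|` grows (`symm_kernel_nonpos`). Hence replacing `w_i w_j` by its value at the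
change of sign only decreases the sum (`sum_mul_nonneg_of_single_crossing`).

What remains is a comparison of the power sums `∑ i + j = N, i ^ a j ^ b / (a! b!)` with `a + b`
fixed. They are the coefficients of `L_a L_b`, where `L_a = ∑ i, (i ^ a / a!) X ^ i` satisfies
`L_{a+1} = X / (1 - X) * ∑ j ≤ a, L_j / (a + 1 - j)!` (`divPowSeries_succ`). Induction with this
recursion gives the coefficientwise inequalities between `L_a L_b` and the products with second
exponent `0` (`divPowSeries_mul_ge_zero`), `1` (`divPowSeries_mul_ge_one`) and, for `b = 3`,
second exponent `2` (`divPowSeries_mul_three_ge`), which are the cases `s = 1, 2, 3`.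
-/

/-! ### Power series with nonnegative coefficients -/

/-- All coefficients of the power series `f` are nonnegative. -/
def PowerSeries.CoeffNonneg (f : PowerSeries ℝ) : Prop :=
  ∀ n, 0 ≤ f.coeff n

namespace PowerSeries.CoeffNonneg

open PowerSeries

lemma zero : CoeffNonneg (0 : PowerSeries ℝ) := fun n => by simp

lemma add {f g : PowerSeries ℝ} (hf : CoeffNonneg f) (hg : CoeffNonneg g) :
    CoeffNonneg (f + g) := fun n => by
  rw [map_add]; exact add_nonneg (hf n) (hg n)

lemma mul {f g : PowerSeries ℝ} (hf : CoeffNonneg f) (hg : CoeffNonneg g) :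
    CoeffNonneg (f * g) := fun n => by
  rw [coeff_mul]; exact Finset.sum_nonneg fun p _ => mul_nonneg (hf _) (hg _)

lemma smul {r : ℝ} (hr : 0 ≤ r) {f : PowerSeries ℝ} (hf : CoeffNonneg f) :
    CoeffNonneg (r • f) := fun n => by
  rw [coeff_smul]; exact mul_nonneg hr (hf n)

lemma sum {ι : Type*} {s : Finset ι} {f : ι → PowerSeries ℝ}
    (hf : ∀ i ∈ s, CoeffNonneg (f i)) : CoeffNonneg (∑ i ∈ s, f i) := fun n => by
  rw [map_sum]; exact Finset.sum_nonneg fun i hi => hf i hi n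

end PowerSeries.CoeffNonneg

/-! ### Generating series of divided powers -/

section DividedPowers

open PowerSeries

/-- The generating series `∑ i ≥ 0, (i ^ a / a!) X ^ i`, with `0 ^ 0 = 1`. -/
noncomputable def divPowSeries (a : ℕ) : PowerSeries ℝ :=
  PowerSeries.mk fun i => (i : ℝ) ^ a / (a ! : ℝ)

/-- The series `∑ i ≥ 1, X ^ i = X / (1 - X)`; multiplication by it is partial summation. -/
noncomputable def shiftGeom : PowerSeries ℝ :=
  PowerSeries.mk fun i => if i = 0 then 0 else 1

lemma coeffNonneg_divPowSeries (a : ℕ) : CoeffNonneg (divPowSeries a) := fun n => by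
  rw [divPowSeries, coeff_mk]; positivity

lemma coeffNonneg_shiftGeom : CoeffNonneg shiftGeom := fun n => by
  rw [shiftGeom, coeff_mk]; split_ifs <;> norm_num

lemma divPowSeries_zero : divPowSeries 0 = 1 + shiftGeom := by
  ext n
  rcases n with _ | n <;> simp [divPowSeries, shiftGeom, coeff_one]

lemma shiftGeom_mul_one_sub_X : shiftGeom * (1 - X) = X := by
  ext n
  rw [mul_sub, mul_one, map_sub]
  rcases n with _ | n
  · simp [shiftGeom]
  · rw [coeff_succ_mul_X, coeff_X]
    rcases n with _ | n <;> simp [shiftGeom]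

/-- The recursion in the exponent, from the binomial expansion of `(i + 1) ^ (a + 1) - i ^ (a + 1)`
and summation over `i`. -/
lemma divPowSeries_succ (a : ℕ) :
    divPowSeries (a + 1) =
      shiftGeom * ∑ j ∈ Finset.range (a + 1), ((a + 1 - j)! : ℝ)⁻¹ • divPowSeries j := by
  have hX : (1 - X : PowerSeries ℝ) ≠ 0 := by
    intro h
    have := congrArg (coeff 0) h
    simp at this
  apply mul_right_cancel₀ hX
  rw [mul_right_comm, shiftGeom_mul_one_sub_X, mul_sub, mul_one]
  ext n
  rw [map_sub]
  rcases n with _ | n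
  · simp [divPowSeries]
  · rw [coeff_succ_mul_X, coeff_succ_X_mul, map_sum]
    simp only [divPowSeries, coeff_mk, coeff_smul, smul_eq_mul]
    rw [← sub_div, div_eq_iff (by positivity), Finset.sum_mul]
    push_cast
    rw [add_pow, Finset.sum_range_succ]
    simp only [one_pow, mul_one, Nat.choose_self, Nat.cast_one, add_sub_cancel_right]
    refine Finset.sum_congr rfl fun j hj => ?_
    have hj' : j ≤ a + 1 := (Finset.mem_range.1 hj).le
    rw [Nat.cast_choose ℝ hj']
    field_simp

/-! ### Comparison of products of divided power series -/

lemma divPowSeries_one : divPowSeries 1 = shiftGeom * divPowSeries 0 := by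
  rw [divPowSeries_succ 0]; simp

lemma factorial_succ_mul_factorial_succ_le (a d : ℕ) :
    (a + 1)! * (d + 1)! ≤ (a + d + 1)! := by
  induction d with
  | zero => simp
  | succ d ih =>
    rw [Nat.factorial_succ (d + 1), ← add_assoc a d 1, Nat.factorial_succ (a + d + 1)]
    calc (a + 1)! * ((d + 1 + 1) * (d + 1)!) = (d + 1 + 1) * ((a + 1)! * (d + 1)!) := by ring
      _ ≤ (a + d + 1 + 1) * (a + d + 1)! := Nat.mul_le_mul (by omega) ih

lemma inv_factorial_le (a d : ℕ) :
    0 ≤ (((a + 1)! : ℝ)⁻¹ * ((d + 1)! : ℝ)⁻¹ - ((a + d + 1)! : ℝ)⁻¹) := by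
  rw [sub_nonneg, ← mul_inv]
  apply inv_anti₀ (by positivity)
  exact_mod_cast factorial_succ_mul_factorial_succ_le a d

/-- Balanced exponents beat the exponents `(a + b + 1, 1)`. Both sides are expanded by the recursion
in the first exponent; after the induction hypothesis the surplus terms are compared one by one,
using `(a + 1)! (d + 1)! ≤ (a + d + 1)!`. -/
lemma divPowSeries_mul_ge_one (a b : ℕ) :
    CoeffNonneg (divPowSeries (a + 1) * divPowSeries (b + 1) -
      divPowSeries 1 * divPowSeries (a + b + 1)) := by
  induction a using Nat.strong_induction_on with
  | _ a ih =>
  have key : divPowSeries (a + 1) * divPowSeries (b + 1) -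
      divPowSeries 1 * divPowSeries (a + b + 1) =
      shiftGeom * (∑ i ∈ Finset.range a, ((a + 1 - (i + 1))! : ℝ)⁻¹ •
          (divPowSeries (i + 1) * divPowSeries (b + 1) -
            divPowSeries 1 * divPowSeries (i + b + 1)) +
        ∑ j ∈ Finset.range b, (((a + 1)! : ℝ)⁻¹ * ((b - j + 1)! : ℝ)⁻¹ -
          ((a + (b - j) + 1)! : ℝ)⁻¹) • (divPowSeries 1 * divPowSeries j)) := by
    have e1 : divPowSeries (a + 1) * divPowSeries (b + 1) =
        shiftGeom * (∑ i ∈ Finset.range a, ((a + 1 - (i + 1))! : ℝ)⁻¹ •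
          (divPowSeries (i + 1) * divPowSeries (b + 1)) +
          ((a + 1)! : ℝ)⁻¹ • (divPowSeries 0 * divPowSeries (b + 1))) := by
      rw [divPowSeries_succ a, Finset.sum_range_succ', mul_assoc, add_mul, Finset.sum_mul]
      simp only [smul_mul_assoc, Nat.sub_zero]
    have e2 : divPowSeries 0 * divPowSeries (b + 1) =
        ∑ j ∈ Finset.range b, ((b - j + 1)! : ℝ)⁻¹ • (divPowSeries 1 * divPowSeries j) +
          divPowSeries 1 * divPowSeries b := by
      rw [divPowSeries_succ b, Finset.sum_range_succ, divPowSeries_one, ← mul_assoc,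
        mul_comm (divPowSeries 0) shiftGeom, mul_add, Finset.mul_sum]
      congr 1
      · refine Finset.sum_congr rfl fun j hj => ?_
        rw [mul_smul_comm, Nat.sub_add_comm (Finset.mem_range.1 hj).le]
      · simp
    have e3 : divPowSeries 1 * divPowSeries (a + b + 1) =
        shiftGeom * (∑ i ∈ Finset.range a, ((a + 1 - (i + 1))! : ℝ)⁻¹ •
          (divPowSeries 1 * divPowSeries (i + b + 1)) +
          ((a + 1)! : ℝ)⁻¹ • (divPowSeries 1 * divPowSeries b) +
          ∑ j ∈ Finset.range b, ((a + (b - j) + 1)! : ℝ)⁻¹ •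
            (divPowSeries 1 * divPowSeries j)) := by
      rw [divPowSeries_succ (a + b), show a + b + 1 = b + (a + 1) by ring, Finset.sum_range_add,
        Finset.sum_range_succ' _ a, mul_left_comm]
      simp only [mul_add, Finset.mul_sum, mul_smul_comm]
      rw [add_comm]
      congr 1
      · congr 1
        · refine Finset.sum_congr rfl fun j hj => ?_
          rw [show b + (a + 1) - (b + (j + 1)) = a + 1 - (j + 1) by omega,
            show b + (j + 1) = j + b + 1 by ring]
        · simp
      · refine Finset.sum_congr rfl fun j hj => ?_
        have := Finset.mem_range.1 hj
        rw [show b + (a + 1) - j = a + (b - j) + 1 by omega]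
    rw [e1, e2, e3]
    simp only [smul_sub, sub_smul, Finset.sum_sub_distrib, smul_add, Finset.smul_sum, smul_smul]
    ring
  rw [key]
  refine coeffNonneg_shiftGeom.mul (.add (.sum fun i hi => .smul (by positivity) ?_)
    (.sum fun j _ => .smul (inv_factorial_le a (b - j)) ?_))
  · exact ih i (Finset.mem_range.1 hi)
  · exact (coeffNonneg_divPowSeries _).mul (coeffNonneg_divPowSeries _)

/-- Balanced exponents beat the exponents `(a + b + 2, 0)`, where `shiftGeom` is the series of the
zeroth powers of the positive integers. The proof is parallel to `divPowSeries_mul_ge_one`. -/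
lemma divPowSeries_mul_ge_zero (a b : ℕ) :
    CoeffNonneg (divPowSeries (a + 1) * divPowSeries (b + 1) -
      shiftGeom * divPowSeries (a + b + 2)) := by
  induction a using Nat.strong_induction_on with
  | _ a ih =>
  have key : divPowSeries (a + 1) * divPowSeries (b + 1) -
      shiftGeom * divPowSeries (a + b + 2) =
      shiftGeom * (∑ i ∈ Finset.range a, ((a + 1 - (i + 1))! : ℝ)⁻¹ •
          (divPowSeries (i + 1) * divPowSeries (b + 1) -
            shiftGeom * divPowSeries (i + b + 2)) +
        ∑ j ∈ Finset.range (b + 1), (((a + 1)! : ℝ)⁻¹ * ((b - j + 1)! : ℝ)⁻¹ -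
          ((a + (b - j + 1) + 1)! : ℝ)⁻¹) • (shiftGeom * divPowSeries j)) := by
    have e1 : divPowSeries (a + 1) * divPowSeries (b + 1) =
        shiftGeom * (∑ i ∈ Finset.range a, ((a + 1 - (i + 1))! : ℝ)⁻¹ •
          (divPowSeries (i + 1) * divPowSeries (b + 1)) +
          ((a + 1)! : ℝ)⁻¹ • (divPowSeries 0 * divPowSeries (b + 1))) := by
      rw [divPowSeries_succ a, Finset.sum_range_succ', mul_assoc, add_mul, Finset.sum_mul]
      simp only [smul_mul_assoc, Nat.sub_zero]
    have e2 : divPowSeries 0 * divPowSeries (b + 1) =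
        ∑ j ∈ Finset.range (b + 1), ((b - j + 1)! : ℝ)⁻¹ • (shiftGeom * divPowSeries j) +
          shiftGeom * divPowSeries (b + 1) := by
      rw [divPowSeries_zero, add_mul, one_mul]
      congr 1
      rw [divPowSeries_succ b, Finset.mul_sum]
      refine Finset.sum_congr rfl fun j hj => ?_
      have := Finset.mem_range.1 hj
      rw [mul_smul_comm, show b + 1 - j = b - j + 1 by omega]
    have e3 : shiftGeom * divPowSeries (a + b + 2) =
        shiftGeom * (∑ i ∈ Finset.range a, ((a + 1 - (i + 1))! : ℝ)⁻¹ •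
          (shiftGeom * divPowSeries (i + b + 2)) +
          ((a + 1)! : ℝ)⁻¹ • (shiftGeom * divPowSeries (b + 1)) +
          ∑ j ∈ Finset.range (b + 1), ((a + (b - j + 1) + 1)! : ℝ)⁻¹ •
            (shiftGeom * divPowSeries j)) := by
      rw [divPowSeries_succ (a + b + 1), show a + b + 1 + 1 = b + 1 + (a + 1) by ring,
        Finset.sum_range_add, Finset.sum_range_succ' _ a]
      simp only [mul_add, Finset.mul_sum, mul_smul_comm]
      rw [add_comm]
      congr 1
      · congr 1
        · refine Finset.sum_congr rfl fun j hj => ?_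
          rw [show b + 1 + (a + 1) - (b + 1 + (j + 1)) = a + 1 - (j + 1) by omega,
            show b + 1 + (j + 1) = j + b + 2 by ring]
        · simp
      · refine Finset.sum_congr rfl fun j hj => ?_
        have := Finset.mem_range.1 hj
        rw [show b + 1 + (a + 1) - j = a + (b - j + 1) + 1 by omega]
    rw [e1, e2, e3]
    simp only [smul_sub, sub_smul, Finset.sum_sub_distrib, smul_add, Finset.smul_sum, smul_smul]
    ring
  rw [key]
  refine coeffNonneg_shiftGeom.mul (.add (.sum fun i hi => .smul (by positivity) ?_)
    (.sum fun j _ => .smul ?_ ?_))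
  · exact ih i (Finset.mem_range.1 hi)
  · refine (inv_factorial_le a (b - j)).trans (sub_le_sub_left ?_ _)
    exact inv_anti₀ (by positivity) (by exact_mod_cast Nat.factorial_le (by omega))
  · exact coeffNonneg_shiftGeom.mul (coeffNonneg_divPowSeries _)

lemma divPowSeries_two :
    divPowSeries 2 = (shiftGeom ^ 2 + (1 / 2 : ℝ) • shiftGeom) * divPowSeries 0 := by
  rw [divPowSeries_succ 1]
  simp only [Finset.sum_range_succ, Finset.range_zero, Finset.sum_empty, divPowSeries_one]
  norm_num
  algebra

lemma divPowSeries_three :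
    divPowSeries 3 =
      (shiftGeom ^ 3 + shiftGeom ^ 2 + (1 / 6 : ℝ) • shiftGeom) * divPowSeries 0 := by
  rw [divPowSeries_succ 2]
  simp only [Finset.sum_range_succ, Finset.range_zero, Finset.sum_empty, divPowSeries_one,
    divPowSeries_two]
  norm_num [Nat.factorial]
  algebra

/-- The exponents `(a + 2, 3)` beat `(a + 3, 2)`, with an explicit surplus: in the recursion for the
difference the terms from the exponents `0` and `1` have a negative part of order `shiftGeom ^ 3`,
which the surplus of the preceding difference absorbs. -/
lemma divPowSeries_mul_three_ge (a : ℕ) :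
    CoeffNonneg (divPowSeries (a + 2) * divPowSeries 3 - divPowSeries (a + 3) * divPowSeries 2 -
      ((a : ℝ) / (6 * ((a + 3)! : ℝ))) • (shiftGeom ^ 2 * divPowSeries 0 ^ 2)) := by
  have hrec (a : ℕ) : divPowSeries (a + 2) * divPowSeries 3 - divPowSeries (a + 3) * divPowSeries 2 =
      shiftGeom * (∑ i ∈ Finset.range a, ((a - i)! : ℝ)⁻¹ •
          (divPowSeries (i + 2) * divPowSeries 3 - divPowSeries (i + 3) * divPowSeries 2) +
        ((a + 1)! : ℝ)⁻¹ • (divPowSeries 1 * divPowSeries 3 - divPowSeries 2 * divPowSeries 2) +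
        ((a + 2)! : ℝ)⁻¹ • (divPowSeries 0 * divPowSeries 3 - divPowSeries 1 * divPowSeries 2) -
        ((a + 3)! : ℝ)⁻¹ • (divPowSeries 0 * divPowSeries 2)) := by
    have e1 : divPowSeries (a + 2) = shiftGeom * (∑ i ∈ Finset.range a, ((a - i)! : ℝ)⁻¹ •
        divPowSeries (i + 2) + ((a + 1)! : ℝ)⁻¹ • divPowSeries 1 +
        ((a + 2)! : ℝ)⁻¹ • divPowSeries 0) := by
      rw [divPowSeries_succ (a + 1), Finset.sum_range_succ', Finset.sum_range_succ']
      simp [Nat.add_sub_add_right, add_assoc]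
    have e2 : divPowSeries (a + 3) = shiftGeom * (∑ i ∈ Finset.range a, ((a - i)! : ℝ)⁻¹ •
        divPowSeries (i + 3) + ((a + 1)! : ℝ)⁻¹ • divPowSeries 2 +
        ((a + 2)! : ℝ)⁻¹ • divPowSeries 1 + ((a + 3)! : ℝ)⁻¹ • divPowSeries 0) := by
      rw [divPowSeries_succ (a + 2), Finset.sum_range_succ', Finset.sum_range_succ',
        Finset.sum_range_succ']
      simp [Nat.add_sub_add_right, add_assoc]
    rw [e1, e2]
    simp only [smul_sub, Finset.sum_sub_distrib, ← smul_mul_assoc, ← Finset.sum_mul]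
    ring
  induction a using Nat.strong_induction_on with
  | _ a ih =>
  have nn (i : ℕ) (hi : i < a) : CoeffNonneg (divPowSeries (i + 2) * divPowSeries 3 -
      divPowSeries (i + 3) * divPowSeries 2) := by
    have h := (ih i hi).add (.smul (r := (i : ℝ) / (6 * ((i + 3)! : ℝ))) (by positivity)
      (((coeffNonneg_shiftGeom.mul coeffNonneg_shiftGeom).mul
        ((coeffNonneg_divPowSeries 0).mul (coeffNonneg_divPowSeries 0)))))
    rwa [← sq, ← sq, sub_add_cancel] at h
  rcases a with _ | a
  · rw [hrec 0, divPowSeries_one, divPowSeries_two, divPowSeries_three]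
    convert CoeffNonneg.zero using 1
    norm_num [Nat.factorial]
    right
    algebra
  · have f2 : ((a + 2)! : ℝ) = (a + 2) * ((a + 1)! : ℝ) := by
      rw [Nat.factorial_succ (a + 1)]; push_cast; ring
    have f3 : ((a + 3)! : ℝ) = (a + 3) * ((a + 2)! : ℝ) := by
      rw [Nat.factorial_succ (a + 2)]; push_cast; ring
    have f4 : ((a + 4)! : ℝ) = (a + 4) * ((a + 3)! : ℝ) := by
      rw [Nat.factorial_succ (a + 3)]; push_cast; ring
    have key : divPowSeries (a + 1 + 2) * divPowSeries 3 -
          divPowSeries (a + 1 + 3) * divPowSeries 2 -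
          (((a + 1 : ℕ) : ℝ) / (6 * ((a + 1 + 3)! : ℝ))) • (shiftGeom ^ 2 * divPowSeries 0 ^ 2) =
        shiftGeom * (∑ i ∈ Finset.range a, ((a + 1 - i)! : ℝ)⁻¹ •
            (divPowSeries (i + 2) * divPowSeries 3 - divPowSeries (i + 3) * divPowSeries 2) +
          (divPowSeries (a + 2) * divPowSeries 3 - divPowSeries (a + 3) * divPowSeries 2 -
            ((a : ℝ) / (6 * ((a + 3)! : ℝ))) • (shiftGeom ^ 2 * divPowSeries 0 ^ 2))) +
        ((a : ℝ) / (6 * (a + 3)! : ℝ) - (a + 1) * a / (12 * (a + 4)!)) •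
          (shiftGeom ^ 3 * divPowSeries 0 ^ 2) := by
      have c1 : ((a + 2)! : ℝ)⁻¹ = (a + 3) * (a + 4) * ((a + 4)! : ℝ)⁻¹ := by
        rw [f4, f3]; field_simp
      have c2 : ((a + 3)! : ℝ)⁻¹ = (a + 4) * ((a + 4)! : ℝ)⁻¹ := by
        rw [f4]; field_simp
      rw [hrec (a + 1), divPowSeries_one, Finset.sum_range_succ]
      simp only [Nat.add_sub_cancel_left, Nat.factorial_one, Nat.cast_one, inv_one, one_smul,
        add_assoc, Nat.reduceAdd, div_eq_mul_inv, mul_inv, c1, c2]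
      generalize ∑ i ∈ Finset.range a, ((a + 1 - i)! : ℝ)⁻¹ • (divPowSeries (i + 2) *
        divPowSeries 3 - divPowSeries (i + 3) * divPowSeries 2) = S
      generalize divPowSeries (a + 2) * divPowSeries 3 - divPowSeries (a + 3) *
        divPowSeries 2 = T
      generalize ((a + 4)! : ℝ)⁻¹ = t
      rw [divPowSeries_two, divPowSeries_three]
      push_cast
      algebra
    rw [key]
    refine (coeffNonneg_shiftGeom.mul (.add (.sum fun i hi => .smul (by positivity) (nn i ?_))
      (ih a (Nat.lt_succ_self a)))).add (.smul ?_ ?_)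
    · exact (Finset.mem_range.1 hi).trans (Nat.lt_succ_self a)
    · rw [f4, sub_nonneg, div_le_div_iff₀ (by positivity) (by positivity)]
      have : (0 : ℝ) ≤ a * ((a + 3)! : ℝ) := by positivity
      nlinarith [mul_nonneg this (Nat.cast_nonneg (α := ℝ) a)]
    · rw [pow_succ, sq, sq]
      exact ((coeffNonneg_shiftGeom.mul coeffNonneg_shiftGeom).mul coeffNonneg_shiftGeom).mul
        ((coeffNonneg_divPowSeries 0).mul (coeffNonneg_divPowSeries 0))

end DividedPowers

/-! ### Unweighted sums over positive pairs with a given sum -/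

/-- The pairs of positive integers with sum `N`. -/
def positivePairs (N : ℕ) : Finset (ℕ × ℕ) :=
  (Finset.HasAntidiagonal.antidiagonal N).filter fun x => 0 < x.1 ∧ 0 < x.2

lemma mem_positivePairs {N : ℕ} {x : ℕ × ℕ} :
    x ∈ positivePairs N ↔ x.1 + x.2 = N ∧ 0 < x.1 ∧ 0 < x.2 := by
  simp [positivePairs]

lemma sum_positivePairs_swap (N : ℕ) (f : ℕ × ℕ → ℝ) :
    ∑ x ∈ positivePairs N, f x.swap = ∑ x ∈ positivePairs N, f x := by
  refine Finset.sum_nbij' Prod.swap Prod.swap ?_ ?_ ?_ ?_ ?_ <;>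
    simp +contextual [mem_positivePairs, add_comm]

lemma coeff_divPowSeries_mul (a b N : ℕ) :
    PowerSeries.coeff N (divPowSeries (a + 1) * divPowSeries (b + 1)) =
      ∑ x ∈ positivePairs N, (x.1 : ℝ) ^ (a + 1) * (x.2 : ℝ) ^ (b + 1) /
        (((a + 1)! : ℝ) * ((b + 1)! : ℝ)) := by
  rw [PowerSeries.coeff_mul, positivePairs, Finset.sum_filter]
  refine Finset.sum_congr rfl fun x _ => ?_
  simp only [divPowSeries, PowerSeries.coeff_mk, div_mul_div_comm]
  split_ifs with h
  · rfl
  · rcases x with ⟨i, j⟩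
    rcases Nat.eq_zero_or_pos i with rfl | hi
    · simp
    · rcases Nat.eq_zero_or_pos j with rfl | hj
      · simp
      · exact absurd ⟨hi, hj⟩ h

lemma coeff_shiftGeom_mul (a N : ℕ) :
    PowerSeries.coeff N (divPowSeries (a + 1) * shiftGeom) =
      ∑ x ∈ positivePairs N, (x.1 : ℝ) ^ (a + 1) * (x.2 : ℝ) ^ 0 /
        (((a + 1)! : ℝ) * (0 ! : ℝ)) := by
  rw [PowerSeries.coeff_mul, positivePairs, Finset.sum_filter]
  refine Finset.sum_congr rfl fun x _ => ?_
  simp only [divPowSeries, shiftGeom, PowerSeries.coeff_mk]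
  rcases x with ⟨i, j⟩
  rcases Nat.eq_zero_or_pos i with rfl | hi
  · simp
  · rcases Nat.eq_zero_or_pos j with rfl | hj
    · simp
    · simp [hi, hj, hj.ne']

/-- For every `N` the sum of `i ^ a j ^ b / (a! b!)` over `i + j = N`, `i, j ≥ 1`, is at least that
of `i ^ R j ^ S / (R! S!)`. -/
def PowerSumLE (R S a b : ℕ) : Prop :=
  ∀ N, ∑ x ∈ positivePairs N, (x.1 : ℝ) ^ R * (x.2 : ℝ) ^ S / ((R ! : ℝ) * (S ! : ℝ)) ≤
    ∑ x ∈ positivePairs N, (x.1 : ℝ) ^ a * (x.2 : ℝ) ^ b / ((a ! : ℝ) * (b ! : ℝ))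

lemma powerSumLE_zero (a b : ℕ) : PowerSumLE (a + b) 0 a b := by
  rcases b with _ | b
  · exact fun N => le_rfl
  rcases a with _ | a
  · intro N
    rw [zero_add, ← sum_positivePairs_swap]
    simp [mul_comm]
  intro N
  have h := divPowSeries_mul_ge_zero a b N
  rw [map_sub, mul_comm shiftGeom, coeff_divPowSeries_mul, coeff_shiftGeom_mul] at h
  rw [show a + 1 + (b + 1) = a + b + 1 + 1 by ring]
  linarith

lemma powerSumLE_one (a b : ℕ) : PowerSumLE (a + b + 1) 1 (a + 1) (b + 1) := by
  intro N
  have h := divPowSeries_mul_ge_one a b N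
  rw [map_sub, mul_comm (divPowSeries 1), coeff_divPowSeries_mul,
    coeff_divPowSeries_mul (a + b) 0] at h
  linarith

lemma powerSumLE_two (a : ℕ) : PowerSumLE (a + 3) 2 (a + 2) 3 := by
  intro N
  have h := (divPowSeries_mul_three_ge a).add
    (PowerSeries.CoeffNonneg.smul (r := (a : ℝ) / (6 * ((a + 3)! : ℝ)))
    (by positivity) ((coeffNonneg_shiftGeom.mul coeffNonneg_shiftGeom).mul
      ((coeffNonneg_divPowSeries 0).mul (coeffNonneg_divPowSeries 0))))
  rw [← sq, ← sq, sub_add_cancel] at h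
  have h := h N
  rw [map_sub, coeff_divPowSeries_mul (a + 1) 2, coeff_divPowSeries_mul (a + 2) 1] at h
  linarith

/-! ### Weighted sums -/

/-- If the weight `W` decreases with the spread `d`, and `p` stays nonpositive beyond a spread where
it is negative, then weighting cannot make the sum of `p` negative. -/
lemma sum_mul_nonneg_of_single_crossing {ι : Type*} (s : Finset ι) (W p d : ι → ℝ)
    (hW0 : ∀ x ∈ s, 0 ≤ W x)
    (hW : ∀ x ∈ s, ∀ y ∈ s, d x ≤ d y → W y ≤ W x)
    (hp : ∀ x ∈ s, ∀ y ∈ s, d x ≤ d y → p x < 0 → p y ≤ 0)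
    (hsum : 0 ≤ ∑ x ∈ s, p x) : 0 ≤ ∑ x ∈ s, W x * p x := by
  classical
  obtain ⟨T, hT0, hT⟩ : ∃ T : ℝ, 0 ≤ T ∧ ∀ x ∈ s, T * p x ≤ W x * p x := by
    by_cases hne : (s.filter fun x => p x < 0).Nonempty
    · -- `T` is the largest weight at which `p` is negative.
      obtain ⟨x₀, hx₀, hmax⟩ := Finset.exists_max_image _ W hne
      rw [Finset.mem_filter] at hx₀
      refine ⟨W x₀, hW0 _ hx₀.1, fun x hx => ?_⟩
      rcases lt_or_ge (p x) 0 with h | h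
      · exact mul_le_mul_of_nonpos_right (hmax x (Finset.mem_filter.2 ⟨hx, h⟩)) h.le
      · rcases le_total (d x) (d x₀) with hd | hd
        · exact mul_le_mul_of_nonneg_right (hW x hx x₀ hx₀.1 hd) h
        · rw [le_antisymm (hp x₀ hx₀.1 x hx hd hx₀.2) h, mul_zero, mul_zero]
    · refine ⟨0, le_rfl, fun x hx => ?_⟩
      have h : 0 ≤ p x := by
        by_contra h
        exact hne ⟨x, Finset.mem_filter.2 ⟨hx, not_le.1 h⟩⟩
      rw [zero_mul]
      exact mul_nonneg (hW0 x hx) h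
  calc 0 ≤ T * ∑ x ∈ s, p x := mul_nonneg hT0 hsum
    _ = ∑ x ∈ s, T * p x := Finset.mul_sum _ _ _
    _ ≤ _ := Finset.sum_le_sum hT

/-! ### The sign pattern of the symmetrised kernel -/

/-- `x ^ a + x ^ b - α (1 + x ^ (a + b))` stays nonpositive as `x ∈ (0, 1]` decreases, since
`(x ^ a + x ^ b) / (1 + x ^ (a + b))` is increasing there. -/
lemma pow_add_pow_sub_nonpos (a b : ℕ) (α : ℝ) {x y : ℝ} (hy : 0 ≤ y) (hyx : y ≤ x)
    (hx1 : x ≤ 1) (h : x ^ a + x ^ b - α * (1 + x ^ (a + b)) ≤ 0) :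
    y ^ a + y ^ b - α * (1 + y ^ (a + b)) ≤ 0 := by
  have hx : 0 ≤ x := hy.trans hyx
  have key : (y ^ a + y ^ b) * (1 + x ^ (a + b)) ≤ (x ^ a + x ^ b) * (1 + y ^ (a + b)) := by
    have mono (k : ℕ) : 0 ≤ x ^ k - y ^ k := sub_nonneg.2 (pow_le_pow_left₀ hy hyx k)
    have small (k : ℕ) : 0 ≤ 1 - (x * y) ^ k :=
      sub_nonneg.2 (pow_le_one₀ (mul_nonneg hx hy) (mul_le_one₀ hx1 hy (hyx.trans hx1)))
    have h1 := mul_nonneg (mono a) (small b)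
    have h2 := mul_nonneg (mono b) (small a)
    rw [mul_pow] at h1 h2
    rw [pow_add, pow_add]
    linarith
  have hxp : 0 < 1 + x ^ (a + b) := by positivity
  have hyp : 0 ≤ 1 + y ^ (a + b) := by positivity
  refine nonpos_of_mul_nonpos_left ?_ hxp
  nlinarith [mul_nonpos_of_nonpos_of_nonneg h hyp]

/-- The homogeneous form of `pow_add_pow_sub_nonpos`. -/
lemma symm_kernel_nonpos (a b s : ℕ) (α : ℝ) {i j k l : ℝ} (hi : 0 < i) (hij : i ≤ j) (hk : 0 < k)
    (hki : k ≤ i) (hsum : k + l = i + j)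
    (h : i ^ (a + s) * j ^ (b + s) + j ^ (a + s) * i ^ (b + s) -
      α * (i ^ (a + b + s) * j ^ s + j ^ (a + b + s) * i ^ s) ≤ 0) :
    k ^ (a + s) * l ^ (b + s) + l ^ (a + s) * k ^ (b + s) -
      α * (k ^ (a + b + s) * l ^ s + l ^ (a + b + s) * k ^ s) ≤ 0 := by
  have hom {u v : ℝ} (hv : 0 < v) : u ^ (a + s) * v ^ (b + s) + v ^ (a + s) * u ^ (b + s) -
      α * (u ^ (a + b + s) * v ^ s + v ^ (a + b + s) * u ^ s) =
      ((u / v) ^ a + (u / v) ^ b - α * (1 + (u / v) ^ (a + b))) *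
        (u ^ s * v ^ s * v ^ (a + b)) := by
    simp only [div_pow, pow_add]
    field_simp
    ring
  have hj : 0 < j := hi.trans_le hij
  have hl : 0 < l := by linarith
  rw [hom hj] at h
  rw [hom hl]
  refine mul_nonpos_of_nonpos_of_nonneg ?_ (by positivity)
  refine pow_add_pow_sub_nonpos a b α (by positivity) ?_ ((div_le_one hj).2 hij)
    (nonpos_of_mul_nonpos_left h (by positivity))
  rw [div_le_div_iff₀ hl hj]
  nlinarith

/-! ### Log-concavity of the weights -/

/-- The ratio `sinh (c x) / sinh x` decreases in `x > 0`; in product form. -/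
lemma sinh_mul_sinh_le {c x y : ℝ} (hc : 0 < c) (hc1 : c < 1) (hx : 0 < x) (hxy : x ≤ y) :
    Real.sinh (c * y) * Real.sinh x ≤ Real.sinh (c * x) * Real.sinh y := by
  have d1 (t : ℝ) : HasDerivAt (fun t => Real.sinh (c * t)) (Real.cosh (c * t) * c) t := by
    simpa using ((hasDerivAt_id t).const_mul c).sinh
  have d2 (t : ℝ) : HasDerivAt (fun t => Real.cosh (c * t)) (Real.sinh (c * t) * c) t := by
    simpa using ((hasDerivAt_id t).const_mul c).cosh
  -- The Wronskian of `sinh (c t)` and `sinh t` increases from `0`.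
  have wr : MonotoneOn (fun t => Real.sinh (c * t) * Real.cosh t -
      Real.cosh (c * t) * c * Real.sinh t) (Ici 0) := by
    refine monotoneOn_of_hasDerivWithinAt_nonneg (f' := fun t => (1 - c ^ 2) *
      (Real.sinh (c * t) * Real.sinh t)) (convex_Ici 0) (by fun_prop) (fun t _ => ?_)
      fun t ht => ?_
    · refine HasDerivAt.hasDerivWithinAt ?_
      convert! ((d1 t).mul (Real.hasDerivAt_cosh t)).sub
        (((d2 t).mul_const c).mul (Real.hasDerivAt_sinh t)) using 1
      ring
    · rw [interior_Ici] at ht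
      have : 0 ≤ Real.sinh (c * t) := Real.sinh_nonneg_iff.2 (mul_nonneg hc.le (le_of_lt ht))
      have : 0 ≤ Real.sinh t := Real.sinh_nonneg_iff.2 (le_of_lt ht)
      have : 0 ≤ 1 - c ^ 2 := by nlinarith
      positivity
  have anti : AntitoneOn (fun t => Real.sinh (c * t) / Real.sinh t) (Ioi 0) := by
    refine antitoneOn_of_hasDerivWithinAt_nonpos (f' := fun t => (Real.cosh (c * t) * c *
      Real.sinh t - Real.sinh (c * t) * Real.cosh t) / Real.sinh t ^ 2) (convex_Ioi 0)
      (fun t ht => ?_) (fun t ht => ?_) fun t ht => ?_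
    · exact (((d1 t).div (Real.hasDerivAt_sinh t)
        (Real.sinh_pos_iff.2 ht).ne').continuousAt).continuousWithinAt
    · rw [interior_Ioi] at ht
      exact ((d1 t).div (Real.hasDerivAt_sinh t) (Real.sinh_pos_iff.2 ht).ne').hasDerivWithinAt
    · rw [interior_Ioi] at ht
      have := wr (mem_Ici.2 le_rfl) (mem_Ici.2 (le_of_lt ht)) (le_of_lt ht)
      simp only [mul_zero, Real.sinh_zero, zero_mul, sub_zero] at this
      exact div_nonpos_of_nonpos_of_nonneg (by linarith) (sq_nonneg _)
  have hy : 0 < y := hx.trans_le hxy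
  have := anti (mem_Ioi.2 hx) (mem_Ioi.2 hy) hxy
  rwa [div_le_div_iff₀ (Real.sinh_pos_iff.2 hy) (Real.sinh_pos_iff.2 hx)] at this

/-- `cosh (c t)` is a concave function of `cosh t`: three-point slope inequality. -/
lemma cosh_slope_le {c x y z : ℝ} (hc : 0 < c) (hc1 : c < 1) (hx : 0 ≤ x) (hxy : x ≤ y)
    (hyz : y < z) :
    (Real.cosh (c * z) - Real.cosh (c * y)) * (Real.cosh z - Real.cosh x) ≤
      (Real.cosh (c * z) - Real.cosh (c * x)) * (Real.cosh z - Real.cosh y) := by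
  rcases hxy.eq_or_lt with rfl | hxy
  · exact le_rfl
  have d2 (t : ℝ) : HasDerivAt (fun t => Real.cosh (c * t)) (Real.sinh (c * t) * c) t := by
    simpa using ((hasDerivAt_id t).const_mul c).cosh
  obtain ⟨u, hu, hu'⟩ := exists_ratio_hasDerivAt_eq_ratio_slope (fun t => Real.cosh (c * t))
    (fun t => Real.sinh (c * t) * c) hxy (by fun_prop) (fun t _ => d2 t) Real.cosh Real.sinh
    (by fun_prop) (fun t _ => Real.hasDerivAt_cosh t)
  obtain ⟨v, hv, hv'⟩ := exists_ratio_hasDerivAt_eq_ratio_slope (fun t => Real.cosh (c * t))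
    (fun t => Real.sinh (c * t) * c) hyz (by fun_prop) (fun t _ => d2 t) Real.cosh Real.sinh
    (by fun_prop) (fun t _ => Real.hasDerivAt_cosh t)
  have hu0 : 0 < u := hx.trans_lt hu.1
  have huv : u < v := hu.2.trans hv.1
  have su : 0 < Real.sinh u := Real.sinh_pos_iff.2 hu0
  have sv : 0 < Real.sinh v := Real.sinh_pos_iff.2 (hu0.trans huv)
  have hs := sinh_mul_sinh_le hc hc1 hu0 huv.le
  have g1 : 0 < Real.cosh y - Real.cosh x :=
    sub_pos.2 (Real.cosh_strictMonoOn hx (hx.trans hxy.le) hxy)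
  have g2 : 0 < Real.cosh z - Real.cosh y :=
    sub_pos.2 (Real.cosh_strictMonoOn (hx.trans hxy.le) (hx.trans (hxy.trans hyz).le) hyz)
  have e1 : Real.cosh (c * y) - Real.cosh (c * x) =
      (Real.cosh y - Real.cosh x) * (Real.sinh (c * u) * c) / Real.sinh u := by
    rw [hu', mul_div_cancel_right₀ _ su.ne']
  have e2 : Real.cosh (c * z) - Real.cosh (c * y) =
      (Real.cosh z - Real.cosh y) * (Real.sinh (c * v) * c) / Real.sinh v := by
    rw [hv', mul_div_cancel_right₀ _ sv.ne']
  have key : (Real.cosh (c * z) - Real.cosh (c * y)) * (Real.cosh y - Real.cosh x) ≤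
      (Real.cosh (c * y) - Real.cosh (c * x)) * (Real.cosh z - Real.cosh y) := by
    rw [e1, e2, div_mul_eq_mul_div, div_mul_eq_mul_div, div_le_div_iff₀ sv su]
    have := mul_le_mul_of_nonneg_left hs (mul_pos (mul_pos g1 g2) hc).le
    linarith
  linarith

lemma one_sub_exp_mul_one_sub_exp (x y : ℝ) :
    (1 - Real.exp (-x)) * (1 - Real.exp (-y)) =
      2 * Real.exp (-((x + y) / 2)) * (Real.cosh ((x + y) / 2) - Real.cosh ((y - x) / 2)) := by
  have h : ∀ u v w : ℝ, u + v = w → Real.exp u * Real.exp v = Real.exp w := fun u v w h => by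
    rw [← Real.exp_add, h]
  rw [Real.cosh_eq, Real.cosh_eq]
  have h1 := h (-((x + y) / 2)) ((x + y) / 2) 0 (by ring)
  have h2 := h (-((x + y) / 2)) (-((x + y) / 2)) (-x + -y) (by ring)
  have h3 := h (-((x + y) / 2)) ((y - x) / 2) (-x) (by ring)
  have h4 := h (-((x + y) / 2)) (-((y - x) / 2)) (-y) (by ring)
  have h5 := h (-x) (-y) _ rfl
  rw [Real.exp_zero] at h1
  linear_combination h5 - h1 - h2 + h3 + h4

/-- The weight `w(t) = (1 - e ^ {-c t}) / (1 - e ^ {-t})`, whose log-concavity for `0 < c < 1` is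
`expWeight_mul_le`. -/
noncomputable def expWeight (c t : ℝ) : ℝ :=
  (1 - Real.exp (-(c * t))) / (1 - Real.exp (-t))

lemma one_sub_exp_neg_pos {t : ℝ} (ht : 0 < t) : 0 < 1 - Real.exp (-t) := by
  rw [sub_pos, Real.exp_lt_one_iff]; linarith

lemma expWeight_nonneg {c t : ℝ} (hc : 0 < c) (ht : 0 < t) : 0 ≤ expWeight c t :=
  div_nonneg (one_sub_exp_neg_pos (mul_pos hc ht)).le (one_sub_exp_neg_pos ht).le

/-- `w(k) w(l) ≤ w(i) w(j)` whenever `k ≤ i ≤ j ≤ l` and `k + l = i + j`. -/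
lemma expWeight_mul_le {c i j k l : ℝ} (hc : 0 < c) (hc1 : c < 1) (hk : 0 < k) (hki : k ≤ i)
    (hij : i ≤ j) (hsum : k + l = i + j) :
    expWeight c k * expWeight c l ≤ expWeight c i * expWeight c j := by
  have hi : 0 < i := hk.trans_le hki
  have hj : 0 < j := hi.trans_le hij
  have hl : 0 < l := by linarith
  simp only [expWeight, div_mul_div_comm]
  rw [div_le_div_iff₀ (mul_pos (one_sub_exp_neg_pos hk) (one_sub_exp_neg_pos hl))
    (mul_pos (one_sub_exp_neg_pos hi) (one_sub_exp_neg_pos hj))]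
  simp only [one_sub_exp_mul_one_sub_exp, ← mul_add, ← mul_sub, mul_div_assoc, hsum]
  have h := cosh_slope_le hc hc1 (x := (j - i) / 2) (y := (l - k) / 2) (z := (i + j) / 2)
    (by linarith) (by linarith) (by linarith)
  have := mul_le_mul_of_nonneg_left h (a := 2 * Real.exp (-(c * ((i + j) / 2))) *
    (2 * Real.exp (-((i + j) / 2)))) (by positivity)
  linarith

/-! ### Nonnegativity of the weighted sums -/

/-- The unweighted comparison `PowerSumLE` survives multiplication by the weights
`w(h i) w(h j)`. -/
lemma weighted_sum_nonneg {h c : ℝ} (hh : 0 < h) (hc : 0 < c) (hc1 : c < 1) (a b s : ℕ)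
    (hle : PowerSumLE (a + b + s) s (a + s) (b + s)) (N : ℕ) :
    0 ≤ ∑ x ∈ positivePairs N, expWeight c (h * x.1) * expWeight c (h * x.2) *
      ((x.1 : ℝ) ^ (a + s) * (x.2 : ℝ) ^ (b + s) -
        (((a + s)! : ℝ) * ((b + s)! : ℝ)) / (((a + b + s)! : ℝ) * (s ! : ℝ)) *
          ((x.1 : ℝ) ^ (a + b + s) * (x.2 : ℝ) ^ s)) := by
  set α : ℝ := (((a + s)! : ℝ) * ((b + s)! : ℝ)) / (((a + b + s)! : ℝ) * (s ! : ℝ)) with hα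
  set W : ℕ × ℕ → ℝ := fun x => expWeight c (h * x.1) * expWeight c (h * x.2) with hWdef
  set p₀ : ℕ × ℕ → ℝ := fun x => (x.1 : ℝ) ^ (a + s) * (x.2 : ℝ) ^ (b + s) -
    α * ((x.1 : ℝ) ^ (a + b + s) * (x.2 : ℝ) ^ s) with hp₀
  change 0 ≤ ∑ x ∈ positivePairs N, W x * p₀ x
  have hWs (x : ℕ × ℕ) : W x.swap = W x := mul_comm _ _
  -- Swapping a pair changes neither the weight nor the symmetrised kernel.
  have order (x : ℕ × ℕ) (hx : x ∈ positivePairs N) : ∃ y ∈ positivePairs N, y.1 ≤ y.2 ∧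
      min x.1 x.2 = y.1 ∧ W y = W x ∧ p₀ y + p₀ y.swap = p₀ x + p₀ x.swap := by
    rcases le_total x.1 x.2 with hle | hle
    · exact ⟨x, hx, hle, min_eq_left hle, rfl, rfl⟩
    · refine ⟨x.swap, ?_, hle, min_eq_right hle, hWs x, ?_⟩
      · rw [mem_positivePairs] at hx ⊢
        exact ⟨(add_comm _ _).trans hx.1, hx.2.2, hx.2.1⟩
      · rw [Prod.swap_swap, add_comm]
  have hsumsymm : ∑ x ∈ positivePairs N, W x * (p₀ x + p₀ x.swap) =
      2 * ∑ x ∈ positivePairs N, W x * p₀ x := by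
    rw [two_mul]
    nth_rewrite 2 [← sum_positivePairs_swap]
    rw [← Finset.sum_add_distrib]
    exact Finset.sum_congr rfl fun x _ => by rw [hWs]; ring
  suffices H : 0 ≤ ∑ x ∈ positivePairs N, W x * (p₀ x + p₀ x.swap) by linarith
  refine sum_mul_nonneg_of_single_crossing _ W _ (fun x => -((min x.1 x.2 : ℕ) : ℝ)) ?_ ?_ ?_ ?_
  · intro x hx
    rw [mem_positivePairs] at hx
    have h1 : (0 : ℝ) < x.1 := by exact_mod_cast hx.2.1
    have h2 : (0 : ℝ) < x.2 := by exact_mod_cast hx.2.2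
    exact mul_nonneg (expWeight_nonneg hc (by positivity)) (expWeight_nonneg hc (by positivity))
  · intro x hx y hy hd
    obtain ⟨x', hx', hx12, hxm, hWx, -⟩ := order x hx
    obtain ⟨y', hy', hy12, hym, hWy, -⟩ := order y hy
    rw [neg_le_neg_iff, hxm, hym] at hd
    rw [← hWx, ← hWy]
    rw [mem_positivePairs] at hx' hy'
    have e : (y'.1 : ℝ) + y'.2 = x'.1 + x'.2 := by exact_mod_cast hy'.1.trans hx'.1.symm
    have h1 : (0 : ℝ) < y'.1 := by exact_mod_cast hy'.2.1
    have h2 : (x'.1 : ℝ) ≤ x'.2 := by exact_mod_cast hx12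
    exact expWeight_mul_le hc hc1 (mul_pos hh h1) (mul_le_mul_of_nonneg_left hd hh.le)
      (mul_le_mul_of_nonneg_left h2 hh.le) (by rw [← mul_add, e, mul_add])
  · intro x hx y hy hd hneg
    obtain ⟨x', hx', hx12, hxm, -, hpx⟩ := order x hx
    obtain ⟨y', hy', hy12, hym, -, hpy⟩ := order y hy
    rw [neg_le_neg_iff, hxm, hym] at hd
    rw [← hpx] at hneg
    rw [← hpy]
    rw [mem_positivePairs] at hx' hy'
    have e : (y'.1 : ℝ) + y'.2 = x'.1 + x'.2 := by exact_mod_cast hy'.1.trans hx'.1.symm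
    have h1 : (0 : ℝ) < y'.1 := by exact_mod_cast hy'.2.1
    have h2 : (x'.1 : ℝ) ≤ x'.2 := by exact_mod_cast hx12
    have h3 : (0 : ℝ) < x'.1 := by exact_mod_cast hx'.2.1
    simp only [hp₀, Prod.fst_swap, Prod.snd_swap] at hneg ⊢
    have := symm_kernel_nonpos a b s α h3 h2 h1 hd e (by linarith)
    linarith
  · rw [Finset.sum_add_distrib, sum_positivePairs_swap]
    have h1 := hle N
    have e : ∑ x ∈ positivePairs N, p₀ x = (((a + s)! : ℝ) * ((b + s)! : ℝ)) *
        (∑ x ∈ positivePairs N, (x.1 : ℝ) ^ (a + s) * (x.2 : ℝ) ^ (b + s) /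
            (((a + s)! : ℝ) * ((b + s)! : ℝ)) -
          ∑ x ∈ positivePairs N, (x.1 : ℝ) ^ (a + b + s) * (x.2 : ℝ) ^ s /
            (((a + b + s)! : ℝ) * (s ! : ℝ))) := by
      rw [← Finset.sum_sub_distrib, Finset.mul_sum]
      refine Finset.sum_congr rfl fun x _ => ?_
      simp only [hp₀, hα]
      field_simp
    have : 0 ≤ ∑ x ∈ positivePairs N, p₀ x := by
      rw [e]
      exact mul_nonneg (by positivity) (sub_nonneg.2 h1)
    linarith

/-! ### Exponential series -/

/-- The series `∑ n, a n * e ^ {-h n x}`. -/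
noncomputable def expSeries (h : ℝ) (a : ℕ → ℝ) (x : ℝ) : ℝ :=
  ∑' n : ℕ, a n * Real.exp (-(h * n * x))

/-- The sequence `a` grows at most polynomially. -/
def PolyBounded (a : ℕ → ℝ) : Prop :=
  ∃ (C : ℝ) (p : ℕ), ∀ n : ℕ, |a n| ≤ C * ((n : ℝ) + 1) ^ p

lemma PolyBounded.const_mul {a : ℕ → ℝ} (ha : PolyBounded a) (r : ℝ) :
    PolyBounded fun n => r * a n := by
  obtain ⟨C, p, h⟩ := ha
  refine ⟨|r| * C, p, fun n => ?_⟩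
  rw [abs_mul, mul_assoc]
  exact mul_le_mul_of_nonneg_left (h n) (abs_nonneg r)

lemma PolyBounded.linear_mul {a : ℕ → ℝ} (ha : PolyBounded a) (r : ℝ) :
    PolyBounded fun n => r * n * a n := by
  obtain ⟨C, p, h⟩ := ha
  refine ⟨|r| * C, p + 1, fun n => ?_⟩
  rw [abs_mul, abs_mul, Nat.abs_cast]
  have h0 : 0 ≤ C * ((n : ℝ) + 1) ^ p := (abs_nonneg _).trans (h n)
  calc |r| * n * |a n| ≤ |r| * ((n : ℝ) + 1) * (C * ((n : ℝ) + 1) ^ p) := by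
        gcongr
        · linarith
        · exact h n
    _ = |r| * C * ((n : ℝ) + 1) ^ (p + 1) := by ring

lemma PolyBounded.linear_pow_mul {a : ℕ → ℝ} (ha : PolyBounded a) (r : ℝ) (k : ℕ) :
    PolyBounded fun n => (r * n) ^ k * a n := by
  induction k with
  | zero => simpa using ha
  | succ k ih =>
    have := ih.linear_mul r
    simpa only [pow_succ', mul_assoc] using this

lemma PolyBounded.sub {a b : ℕ → ℝ} (ha : PolyBounded a) (hb : PolyBounded b) :
    PolyBounded fun n => a n - b n := by
  obtain ⟨C, p, h⟩ := ha
  obtain ⟨D, q, h'⟩ := hb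
  have hC : 0 ≤ C := by simpa using (abs_nonneg _).trans (h 0)
  have hD : 0 ≤ D := by simpa using (abs_nonneg _).trans (h' 0)
  refine ⟨C + D, p + q, fun n => ?_⟩
  have h1 : (1 : ℝ) ≤ (n : ℝ) + 1 := by simp
  calc |a n - b n| ≤ |a n| + |b n| := abs_sub _ _
    _ ≤ C * ((n : ℝ) + 1) ^ (p + q) + D * ((n : ℝ) + 1) ^ (p + q) :=
      add_le_add ((h n).trans (mul_le_mul_of_nonneg_left (pow_le_pow_right₀ h1 (by omega)) hC))
        ((h' n).trans (mul_le_mul_of_nonneg_left (pow_le_pow_right₀ h1 (by omega)) hD))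
    _ = _ := by ring

lemma PolyBounded.antidiagonal {a b : ℕ → ℝ} (ha : PolyBounded a) (hb : PolyBounded b) :
    PolyBounded fun n => ∑ x ∈ Finset.HasAntidiagonal.antidiagonal n, a x.1 * b x.2 := by
  obtain ⟨C, p, h⟩ := ha
  obtain ⟨D, q, h'⟩ := hb
  have hC : 0 ≤ C := by simpa using (abs_nonneg _).trans (h 0)
  have hD : 0 ≤ D := by simpa using (abs_nonneg _).trans (h' 0)
  refine ⟨C * D, p + q + 1, fun n => ?_⟩
  calc |∑ x ∈ Finset.HasAntidiagonal.antidiagonal n, a x.1 * b x.2|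
      ≤ ∑ x ∈ Finset.HasAntidiagonal.antidiagonal n, |a x.1 * b x.2| :=
        Finset.abs_sum_le_sum_abs _ _
    _ ≤ ∑ x ∈ Finset.HasAntidiagonal.antidiagonal n,
        (C * ((n : ℝ) + 1) ^ p) * (D * ((n : ℝ) + 1) ^ q) := by
        refine Finset.sum_le_sum fun x hx => ?_
        have hx' := Finset.HasAntidiagonal.mem_antidiagonal.1 hx
        have h1 : (x.1 : ℝ) ≤ n := by exact_mod_cast (by omega : x.1 ≤ n)
        have h2 : (x.2 : ℝ) ≤ n := by exact_mod_cast (by omega : x.2 ≤ n)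
        rw [abs_mul]
        refine mul_le_mul ((h _).trans ?_) ((h' _).trans ?_) (abs_nonneg _) (by positivity)
        · gcongr
        · gcongr
    _ = C * D * ((n : ℝ) + 1) ^ (p + q + 1) := by
        rw [Finset.sum_const, Finset.Nat.card_antidiagonal, nsmul_eq_mul]
        push_cast
        ring

lemma summable_pow_mul_exp (p : ℕ) {t : ℝ} (ht : 0 < t) :
    Summable fun n : ℕ => ((n : ℝ) + 1) ^ p * Real.exp (-(t * n)) := by
  have h := (summable_nat_add_iff 1).2 (Real.summable_pow_mul_exp_neg_nat_mul p ht)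
  refine (h.mul_right (Real.exp t)).congr fun n => ?_
  rw [mul_assoc, ← Real.exp_add]
  push_cast
  congr 2
  ring

lemma PolyBounded.summable_norm {a : ℕ → ℝ} (ha : PolyBounded a) {h x : ℝ} (hh : 0 < h)
    (hx : 0 < x) : Summable fun n : ℕ => ‖a n * Real.exp (-(h * n * x))‖ := by
  obtain ⟨C, p, hC⟩ := ha
  refine Summable.of_nonneg_of_le (fun _ => norm_nonneg _) (fun n => ?_)
    ((summable_pow_mul_exp p (mul_pos hh hx)).mul_left C)
  rw [norm_mul, Real.norm_eq_abs, Real.norm_eq_abs, Real.abs_exp, ← mul_assoc,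
    show h * x * n = h * n * x by ring]
  exact mul_le_mul_of_nonneg_right (hC n) (Real.exp_pos _).le

lemma PolyBounded.summable {a : ℕ → ℝ} (ha : PolyBounded a) {h x : ℝ} (hh : 0 < h)
    (hx : 0 < x) : Summable fun n : ℕ => a n * Real.exp (-(h * n * x)) :=
  (ha.summable_norm hh hx).of_norm

lemma hasDerivAt_expSeries {a : ℕ → ℝ} (ha : PolyBounded a) {h x : ℝ} (hh : 0 < h)
    (hx : 0 < x) :
    HasDerivAt (expSeries h a) (expSeries h (fun n => -h * n * a n) x) x := by
  obtain ⟨C, p, hC⟩ := ha.linear_mul (-h)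
  have hx2 : 0 < x / 2 := by linarith
  refine hasDerivAt_tsum_of_isPreconnected (t := Ioi (x / 2)) (y₀ := x)
    (g := fun n y => a n * Real.exp (-(h * n * y)))
    (g' := fun n y => -h * n * a n * Real.exp (-(h * n * y)))
    ((summable_pow_mul_exp p (mul_pos hh hx2)).mul_left C)
    isOpen_Ioi isPreconnected_Ioi (fun n y _ => ?_) (fun n y hy => ?_) (mem_Ioi.2 (by linarith))
    (ha.summable hh hx) (mem_Ioi.2 (by linarith))
  · have := (((hasDerivAt_id y).const_mul (h * n)).neg.exp).const_mul (a n)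
    convert! this using 1
    simp only [Pi.neg_apply, id_eq, mul_one]
    ring
  · rw [norm_mul, Real.norm_eq_abs, Real.norm_eq_abs, Real.abs_exp, ← mul_assoc]
    refine mul_le_mul (hC n) (Real.exp_le_exp.2 ?_) (Real.exp_pos _).le
      ((abs_nonneg _).trans (hC n))
    have := mul_le_mul_of_nonneg_left (le_of_lt (mem_Ioi.1 hy))
      (mul_nonneg hh.le (Nat.cast_nonneg (α := ℝ) n))
    linarith

/-- Iterated derivatives of an exponential series plus an affine function. The linear term is gone
after one derivative. -/
lemma iteratedDeriv_affine_add_expSeries {a : ℕ → ℝ} (ha : PolyBounded a) {h : ℝ} (hh : 0 < h)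
    {f : ℝ → ℝ} {u v : ℝ} (hf : ∀ x, 0 < x → f x = u + v * x + expSeries h a x) (k : ℕ) :
    ∃ u' v' : ℝ, (v = 0 ∨ 0 < k → v' = 0) ∧ (v = 0 → u = 0 → u' = 0) ∧ ∀ x, 0 < x →
      iteratedDeriv k f x = u' + v' * x + expSeries h (fun n => (-h * n) ^ k * a n) x := by
  induction k with
  | zero =>
    refine ⟨u, v, ?_, fun _ h => h, fun x hx => ?_⟩
    · simp
    · simpa using hf x hx
  | succ k ih =>
    obtain ⟨u', v', hv', hu', hf'⟩ := ih
    refine ⟨v', 0, fun _ => rfl, fun h _ => hv' (Or.inl h), fun x hx => ?_⟩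
    rw [iteratedDeriv_succ]
    have hev : iteratedDeriv k f =ᶠ[nhds x] fun x => u' + v' * x +
        expSeries h (fun n => (-h * n) ^ k * a n) x :=
      Filter.eventuallyEq_of_mem (Ioi_mem_nhds hx) hf'
    rw [hev.deriv_eq]
    have h1 := hasDerivAt_expSeries (ha.linear_pow_mul (-h) k) hh hx
    have h2 := (((hasDerivAt_id x).const_mul v').const_add u').add h1
    refine h2.deriv.trans ?_
    simp only [mul_one, zero_mul, add_zero, pow_succ', mul_assoc]

lemma iteratedDeriv_expSeries {a : ℕ → ℝ} (ha : PolyBounded a) {h : ℝ} (hh : 0 < h) (k : ℕ)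
    {x : ℝ} (hx : 0 < x) :
    iteratedDeriv k (expSeries h a) x = expSeries h (fun n => (-h * n) ^ k * a n) x := by
  obtain ⟨u', v', hv', hu', hf'⟩ := iteratedDeriv_affine_add_expSeries ha hh (f := expSeries h a)
    (u := 0) (v := 0) (by simp) k
  rw [hf' x hx, hv' (Or.inl rfl), hu' rfl rfl]
  ring

/-- An exponential series with nonnegative coefficients is completely monotonic. -/
lemma completelyMonotonicOn_expSeries {a : ℕ → ℝ} (ha : PolyBounded a) (ha0 : ∀ n, 0 ≤ a n)
    {h : ℝ} (hh : 0 < h) : CompletelyMonotonicOn (expSeries h a) (Ioi 0) := by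
  have heq (k : ℕ) : EqOn (iteratedDerivWithin k (expSeries h a) (Ioi 0))
      (expSeries h fun n => (-h * n) ^ k * a n) (Ioi 0) := fun x hx => by
    rw [iteratedDerivWithin_of_isOpen isOpen_Ioi hx, iteratedDeriv_expSeries ha hh k hx]
  refine ⟨contDiffOn_of_differentiableOn_deriv fun k _ => ?_, fun k x hx => ?_⟩
  · refine DifferentiableOn.congr (fun x hx => ?_) (heq k)
    exact (hasDerivAt_expSeries (ha.linear_pow_mul (-h) k) hh hx).differentiableAt
      |>.differentiableWithinAt
  · rw [heq k hx, expSeries, ← tsum_mul_left]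
    refine tsum_nonneg fun n => ?_
    rw [neg_mul, neg_pow (h * n), mul_assoc, mul_assoc, ← mul_assoc ((-1 : ℝ) ^ k), ← mul_pow]
    have := ha0 n
    norm_num
    positivity

lemma CompletelyMonotonicOn.congr {f g : ℝ → ℝ} {s : Set ℝ} (hf : CompletelyMonotonicOn f s)
    (h : EqOn g f s) : CompletelyMonotonicOn g s :=
  ⟨hf.1.congr h, fun k x hx => by rw [iteratedDerivWithin_congr h hx]; exact hf.2 k x hx⟩

lemma expSeries_mul {a b : ℕ → ℝ} (ha : PolyBounded a) (hb : PolyBounded b) {h x : ℝ}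
    (hh : 0 < h) (hx : 0 < x) :
    expSeries h a x * expSeries h b x = expSeries h
      (fun n => ∑ y ∈ Finset.HasAntidiagonal.antidiagonal n, a y.1 * b y.2) x := by
  rw [expSeries, expSeries, tsum_mul_tsum_eq_tsum_sum_antidiagonal_of_summable_norm
    (ha.summable_norm hh hx) (hb.summable_norm hh hx), expSeries]
  refine tsum_congr fun n => ?_
  rw [Finset.sum_mul]
  refine Finset.sum_congr rfl fun y hy => ?_
  rw [mul_mul_mul_comm, ← Real.exp_add, ← Finset.HasAntidiagonal.mem_antidiagonal.1 hy]
  push_cast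
  congr 2
  ring

lemma expSeries_sub {a b : ℕ → ℝ} (ha : PolyBounded a) (hb : PolyBounded b) {h x : ℝ}
    (hh : 0 < h) (hx : 0 < x) :
    expSeries h a x - expSeries h b x = expSeries h (fun n => a n - b n) x := by
  rw [expSeries, expSeries, ← (ha.summable hh hx).tsum_sub (hb.summable hh hx), expSeries]
  exact tsum_congr fun n => by ring

lemma expSeries_const_mul (a : ℕ → ℝ) (r h x : ℝ) :
    r * expSeries h a x = expSeries h (fun n => r * a n) x := by
  rw [expSeries, expSeries, ← tsum_mul_left]
  exact tsum_congr fun n => by ring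

/-! ### The `q`-gamma function as an exponential series -/

/-- The coefficients `1 / (j (1 - e ^ {-h j}))` of `log Γ_q` with `e ^ {-h} = min q q⁻¹`; the
division by zero at `j = 0` gives the wanted value `0`. -/
noncomputable def logGammaCoeff (h : ℝ) (j : ℕ) : ℝ :=
  1 / (j * (1 - Real.exp (-(h * j))))

lemma one_sub_exp_le {h : ℝ} (hh : 0 < h) {j : ℕ} (hj : 0 < j) :
    1 - Real.exp (-h) ≤ 1 - Real.exp (-(h * j)) := by
  have : (1 : ℝ) ≤ j := by exact_mod_cast hj
  have := mul_le_mul_of_nonneg_left this hh.le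
  gcongr
  linarith

lemma polyBounded_logGammaCoeff {h : ℝ} (hh : 0 < h) : PolyBounded (logGammaCoeff h) := by
  refine ⟨1 / (1 - Real.exp (-h)), 0, fun j => ?_⟩
  have h0 := one_sub_exp_neg_pos hh
  rw [pow_zero, mul_one, logGammaCoeff]
  rcases Nat.eq_zero_or_pos j with rfl | hj
  · simpa using h0.le
  · have h1 := one_sub_exp_le hh hj
    have hj1 : (1 : ℝ) ≤ j := by exact_mod_cast hj
    have h2 : 1 - Real.exp (-h) ≤ j * (1 - Real.exp (-(h * j))) := by nlinarith
    rw [abs_of_nonneg (by have := h0.trans_le h2; positivity)]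
    exact one_div_le_one_div_of_le h0 h2

/-- Expansion of `∑ n, -log (1 - e ^ {-h (n + x)})`: the logarithms are expanded and the order of
summation is exchanged. -/
lemma hasSum_neg_log_one_sub_exp {h x : ℝ} (hh : 0 < h) (hx : 0 < x) :
    HasSum (fun n : ℕ => -Real.log (1 - Real.exp (-(h * (n + x)))))
      (expSeries h (logGammaCoeff h) x) := by
  set F : ℕ × ℕ → ℝ := fun y => Real.exp (-(h * (y.1 + x))) ^ (y.2 + 1) / (y.2 + 1) with hF
  have hFe (n j : ℕ) : F (n, j) =
      Real.exp (-(h * (j + 1))) ^ n * (Real.exp (-(h * (j + 1) * x)) / (j + 1)) := by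
    simp only [hF, ← Real.exp_nat_mul]
    rw [← mul_div_assoc, ← Real.exp_add]
    push_cast
    congr 2
    ring
  have hFs : Summable F := by
    have h1 : Summable fun n : ℕ => Real.exp (-h) ^ n :=
      summable_geometric_of_lt_one (Real.exp_pos _).le (by rw [Real.exp_lt_one_iff]; linarith)
    have h2 : Summable fun n : ℕ => Real.exp (-(h * x)) ^ n :=
      summable_geometric_of_lt_one (Real.exp_pos _).le
        (by rw [Real.exp_lt_one_iff]; have := mul_pos hh hx; linarith)
    refine Summable.of_nonneg_of_le (fun y => by positivity) (fun y => ?_)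
      (h1.mul_of_nonneg h2 (fun _ => by positivity) fun _ => by positivity)
    obtain ⟨n, j⟩ := y
    rw [hFe]
    refine mul_le_mul (pow_le_pow_left₀ (Real.exp_pos _).le (Real.exp_le_exp.2 ?_) _)
      ((div_le_self (Real.exp_pos _).le (by simp)).trans ?_) (by positivity) (by positivity)
    · have : 0 ≤ h * j := by positivity
      linarith
    · rw [← Real.exp_nat_mul]
      apply Real.exp_le_exp.2
      have := mul_pos hh hx
      linarith
  have rows (n : ℕ) : HasSum (fun j => F (n, j)) (-Real.log (1 - Real.exp (-(h * (n + x))))) := by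
    simp only [hF]
    apply Real.hasSum_pow_div_log_of_abs_lt_one
    rw [Real.abs_exp, Real.exp_lt_one_iff, neg_lt_zero]
    positivity
  have cols (j : ℕ) : HasSum (fun n => F (n, j))
      (logGammaCoeff h (j + 1) * Real.exp (-(h * (j + 1 : ℕ) * x))) := by
    have hj : 0 < h * ((j : ℝ) + 1) := by positivity
    have := (hasSum_geometric_of_lt_one (Real.exp_pos _).le
      (show Real.exp (-(h * (j + 1))) < 1 by rw [Real.exp_lt_one_iff]; linarith)).mul_right
        (Real.exp (-(h * (j + 1) * x)) / (j + 1))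
    simp only [hFe]
    convert! this using 1
    have := (one_sub_exp_neg_pos hj).ne'
    rw [logGammaCoeff]
    push_cast
    field_simp
  have h1 := hFs.hasSum.prod_fiberwise rows
  have h2 := ((Equiv.prodComm ℕ ℕ).hasSum_iff.2 hFs.hasSum).prod_fiberwise cols
  have h3 := (hasSum_nat_add_iff (f := fun j : ℕ => logGammaCoeff h j * Real.exp (-(h * j * x)))
    1).1 h2
  rw [Finset.sum_range_one, logGammaCoeff, Nat.cast_zero, zero_mul, div_zero, zero_mul,
    add_zero] at h3
  rw [expSeries, h3.tsum_eq]
  exact h1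

lemma tprod_one_sub_exp_div {h x : ℝ} (hh : 0 < h) (hx : 0 < x) :
    ∏' n : ℕ, (1 - Real.exp (-(h * (n + 1)))) / (1 - Real.exp (-(h * (n + x)))) =
      Real.exp (expSeries h (logGammaCoeff h) x - expSeries h (logGammaCoeff h) 1) := by
  have := ((hasSum_neg_log_one_sub_exp hh hx).sub (hasSum_neg_log_one_sub_exp hh one_pos)).rexp
  rw [← this.tprod_eq]
  refine tprod_congr fun n => ?_
  have h1 : 0 < 1 - Real.exp (-(h * (n + 1))) := one_sub_exp_neg_pos (by positivity)
  have h2 : 0 < 1 - Real.exp (-(h * (n + x))) := one_sub_exp_neg_pos (by positivity)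
  rw [Function.comp_apply, neg_sub_neg, Real.exp_sub, Real.exp_log h1, Real.exp_log h2]

/-- Up to a quadratic polynomial, which is affine if `q < 1`, `log Γ_q` is an exponential series. -/
lemma qGamma_eq_exp {q : ℝ} (hq : 0 < q) (hq1 : q ≠ 1) :
    ∃ h > 0, ∃ u v w : ℝ, (q < 1 → w = 0) ∧ ∀ x, 0 < x →
      qGamma q x = Real.exp (u + v * x + w * x ^ 2 + expSeries h (logGammaCoeff h) x) := by
  rcases hq1.lt_or_gt with hlt | hgt
  · have hl := Real.log_neg hq hlt
    refine ⟨-Real.log q, by linarith, Real.log (1 - q) -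
      expSeries (-Real.log q) (logGammaCoeff (-Real.log q)) 1, -Real.log (1 - q), 0, fun _ => rfl,
      fun x hx => ?_⟩
    have e1 (n : ℕ) : q ^ (n + 1) = Real.exp (-(-Real.log q * (n + 1))) := by
      rw [neg_mul, neg_neg, ← Real.rpow_def_of_pos hq]
      exact_mod_cast (Real.rpow_natCast q (n + 1)).symm
    have e2 (n : ℕ) : q ^ ((n : ℝ) + x) = Real.exp (-(-Real.log q * (n + x))) := by
      rw [neg_mul, neg_neg, ← Real.rpow_def_of_pos hq]
    simp only [qGamma, if_pos hlt, e1, e2]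
    rw [tprod_one_sub_exp_div (by linarith) hx, Real.rpow_def_of_pos (by linarith),
      ← Real.exp_add]
    congr 1
    ring
  · have hl := Real.log_pos hgt
    refine ⟨Real.log q, hl, Real.log (q - 1) -
      expSeries (Real.log q) (logGammaCoeff (Real.log q)) 1, -Real.log (q - 1) - Real.log q / 2,
      Real.log q / 2, fun h => absurd h hgt.not_gt, fun x hx => ?_⟩
    have e1 (n : ℕ) : (q ^ (n + 1))⁻¹ = Real.exp (-(Real.log q * (n + 1))) := by
      rw [Real.exp_neg, ← Real.rpow_def_of_pos hq]
      congr 1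
      exact_mod_cast (Real.rpow_natCast q (n + 1)).symm
    have e2 (n : ℕ) : q ^ (-((n : ℝ) + x)) = Real.exp (-(Real.log q * (n + x))) := by
      rw [Real.rpow_neg hq.le, Real.exp_neg, ← Real.rpow_def_of_pos hq]
    simp only [qGamma, if_neg hgt.not_gt, e1, e2]
    rw [tprod_one_sub_exp_div hl hx, Real.rpow_def_of_pos (by linarith),
      Real.rpow_def_of_pos hq, ← Real.exp_add, ← Real.exp_add]
    congr 1
    ring

lemma qDigamma_eq {q : ℝ} (hq : 0 < q) (hq1 : q ≠ 1) :
    ∃ h > 0, ∃ u v : ℝ, (q < 1 → v = 0) ∧ ∀ x, 0 < x →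
      qDigamma q x = u + v * x + expSeries h (fun n => -h * n * logGammaCoeff h n) x := by
  obtain ⟨h, hh, u, v, w, hw, hG⟩ := qGamma_eq_exp hq hq1
  refine ⟨h, hh, v, 2 * w, fun hlt => by rw [hw hlt, mul_zero], fun x hx => ?_⟩
  have hev : qGamma q =ᶠ[nhds x] fun x =>
      Real.exp (u + v * x + w * x ^ 2 + expSeries h (logGammaCoeff h) x) :=
    Filter.eventuallyEq_of_mem (Ioi_mem_nhds hx) hG
  have hd := (((((hasDerivAt_id x).const_mul v).const_add u).add
    (((hasDerivAt_id x).pow 2).const_mul w)).add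
      (hasDerivAt_expSeries (polyBounded_logGammaCoeff hh) hh hx)).exp
  rw [qDigamma, logDeriv_apply, hev.deriv_eq, hG x hx]
  refine (congrArg (· / _) hd.deriv).trans ?_
  simp only [Pi.add_apply, Pi.pow_apply, id_eq]
  rw [mul_div_cancel_left₀ _ (Real.exp_pos _).ne']
  simp
  ring

/-! ### Finite differences of the `q`-polygamma functions -/

/-- The coefficients of `(-1) ^ k Δ ψ_q ^ (k)` as an exponential series. -/
noncomputable def finDiffCoeff (h c : ℝ) (k n : ℕ) : ℝ :=
  h / c * ((h * n) ^ k * expWeight c (h * n))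

lemma polyBounded_finDiffCoeff {h c : ℝ} (hh : 0 < h) (hc : 0 < c) (k : ℕ) :
    PolyBounded (finDiffCoeff h c k) := by
  have : PolyBounded fun n : ℕ => expWeight c (h * n) := by
    refine ⟨1 / (1 - Real.exp (-h)), 0, fun n => ?_⟩
    have h0 := one_sub_exp_neg_pos hh
    rw [pow_zero, mul_one]
    rcases Nat.eq_zero_or_pos n with rfl | hn
    · simpa [expWeight] using h0.le
    · have hn' : (0 : ℝ) < n := by exact_mod_cast hn
      rw [abs_of_nonneg (expWeight_nonneg hc (by positivity)), expWeight]
      have := Real.exp_pos (-(c * (h * n)))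
      exact div_le_div₀ zero_le_one (by linarith) h0 (one_sub_exp_le hh hn)
  exact (this.linear_pow_mul h k).const_mul (h / c)

lemma finDiff_qPolygammaPred {q c : ℝ} (hq : 0 < q) (hq1 : q ≠ 1) (hc : 0 < c) :
    ∃ h > 0, ∀ k : ℕ, (q < 1 ∨ 0 < k) → ∀ x, 0 < x →
      finDiff (qPolygammaPred q (k + 1)) x c = (-1) ^ k * expSeries h (finDiffCoeff h c k) x := by
  obtain ⟨h, hh, u, v, hv, hψ⟩ := qDigamma_eq hq hq1
  refine ⟨h, hh, fun k hk x hx => ?_⟩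
  have hb := (polyBounded_logGammaCoeff hh).linear_mul (-h)
  obtain ⟨u', v', hv', -, hf⟩ := iteratedDeriv_affine_add_expSeries hb hh hψ k
  have hb' := hb.linear_pow_mul (-h) k
  have hxc : 0 < x + c := by linarith
  rw [finDiff, qPolygammaPred, hf _ hxc, hf x hx, hv' (hk.imp_left hv)]
  rw [zero_mul, zero_mul, add_sub_add_left_eq_sub, expSeries, expSeries,
    ← (hb'.summable hh hxc).tsum_sub (hb'.summable hh hx), ← tsum_div_const, expSeries,
    ← tsum_mul_left]
  refine tsum_congr fun n => ?_
  rcases Nat.eq_zero_or_pos n with rfl | hn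
  · simp [finDiffCoeff, expWeight]
  · have hn' : (0 : ℝ) < n := by exact_mod_cast hn
    have h0 := (one_sub_exp_neg_pos (mul_pos hh hn')).ne'
    rw [show -(h * n * (x + c)) = -(c * (h * n)) + -(h * n * x) by ring, Real.exp_add,
      logGammaCoeff, finDiffCoeff, expWeight, neg_mul h, neg_pow (h * n)]
    field_simp
    ring

/-- `F_{r,m,n,s}` for shifted indices: the exponents `a + s`, `b + s`, `a + b + s`, `s` are
`m - 1`, `n - 1`, `r - 1`, `s - 1`. -/
lemma completelyMonotonicOn_qF {q c : ℝ} (hq : 0 < q) (hq1 : q ≠ 1) (hc : 0 < c) (hc1 : c < 1)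
    (a b s : ℕ) (hs : q < 1 ∨ 0 < s) (hle : PowerSumLE (a + b + s) s (a + s) (b + s)) :
    CompletelyMonotonicOn (qF (a + b + s + 1) (a + s + 1) (b + s + 1) (s + 1) q c) (Ioi 0) := by
  obtain ⟨h, hh, hD⟩ := finDiff_qPolygammaPred hq hq1 hc
  set α := alphaConst (a + b + s + 1) (a + s + 1) (b + s + 1) (s + 1) with hα
  have pb := polyBounded_finDiffCoeff hh hc
  have pb1 := (pb (a + s)).antidiagonal (pb (b + s))
  have pb2 := ((pb (a + b + s)).antidiagonal (pb s)).const_mul α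
  refine (completelyMonotonicOn_expSeries (pb1.sub pb2) (fun N => ?_) hh).congr fun x hx => ?_
  · have key : ∑ y ∈ Finset.HasAntidiagonal.antidiagonal N,
        finDiffCoeff h c (a + s) y.1 * finDiffCoeff h c (b + s) y.2 -
        α * ∑ y ∈ Finset.HasAntidiagonal.antidiagonal N,
          finDiffCoeff h c (a + b + s) y.1 * finDiffCoeff h c s y.2 =
        (h / c) ^ 2 * h ^ (a + b + 2 * s) * ∑ y ∈ positivePairs N,
          expWeight c (h * y.1) * expWeight c (h * y.2) *
            ((y.1 : ℝ) ^ (a + s) * (y.2 : ℝ) ^ (b + s) -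
              (((a + s)! : ℝ) * ((b + s)! : ℝ)) / (((a + b + s)! : ℝ) * (s ! : ℝ)) *
                ((y.1 : ℝ) ^ (a + b + s) * (y.2 : ℝ) ^ s)) := by
      have hα' : α = (((a + s)! : ℝ) * ((b + s)! : ℝ)) / (((a + b + s)! : ℝ) * (s ! : ℝ)) := by
        simp [hα, alphaConst]
      rw [← hα', Finset.mul_sum, ← Finset.sum_sub_distrib, Finset.mul_sum, positivePairs,
        Finset.sum_filter]
      refine Finset.sum_congr rfl fun y _ => ?_
      obtain ⟨i, j⟩ := y
      split_ifs with hij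
      · simp only [finDiffCoeff]
        ring
      · have : expWeight c (h * i) * expWeight c (h * j) = 0 := by
          rcases Nat.eq_zero_or_pos i with rfl | hi
          · simp [expWeight]
          · rcases Nat.eq_zero_or_pos j with rfl | hj
            · simp [expWeight]
            · exact absurd ⟨hi, hj⟩ hij
        simp only [finDiffCoeff]
        linear_combination (h / c) ^ 2 * ((h * i) ^ (a + s) * (h * j) ^ (b + s) -
          α * ((h * i) ^ (a + b + s) * (h * j) ^ s)) * this
    rw [key]
    exact mul_nonneg (by positivity) (weighted_sum_nonneg hh hc hc1 a b s hle N)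
  · have hx : 0 < x := hx
    have sgn (k l : ℕ) : ((-1 : ℝ)) ^ (k + 1 + (l + 1)) * (-1) ^ k * (-1) ^ l = 1 := by
      rw [← pow_add, ← pow_add, show k + 1 + (l + 1) + k + l = 2 * (k + l + 1) by ring, pow_mul]
      simp
    rw [qF, hD (a + s) (hs.imp_right fun h => by omega) x hx,
      hD (b + s) (hs.imp_right fun h => by omega) x hx,
      hD (a + b + s) (hs.imp_right fun h => by omega) x hx, hD s hs x hx,
      ← expSeries_sub pb1 pb2 hh hx, ← expSeries_const_mul, ← expSeries_mul (pb _) (pb _) hh hx,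
      ← expSeries_mul (pb _) (pb _) hh hx, ← hα]
    linear_combination expSeries h (finDiffCoeff h c (a + s)) x *
      expSeries h (finDiffCoeff h c (b + s)) x * sgn (a + s) (b + s) -
      α * expSeries h (finDiffCoeff h c (a + b + s)) x *
      expSeries h (finDiffCoeff h c s) x * sgn (a + b + s) s

theorem theorem2 (q c : ℝ) (hq : 0 < q) (hq1 : q ≠ 1) (hc : 0 < c) (hc1 : c < 1)
    (r m n s : ℕ) (hs : 1 ≤ s) (hsn : s ≤ n) (hnm : n ≤ m) (hmr : m ≤ r)
    (hsum : r + s = m + n) :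
    (s = 1 → q < 1 → CompletelyMonotonicOn (qF r m n s q c) (Ioi 0)) ∧
    (s = 2 → CompletelyMonotonicOn (qF r m n s q c) (Ioi 0)) ∧
    (s = 3 → n = 4 → CompletelyMonotonicOn (qF r m n s q c) (Ioi 0)) := by
  obtain ⟨b, rfl⟩ := Nat.exists_eq_add_of_le hsn
  obtain ⟨a, rfl⟩ := Nat.exists_eq_add_of_le (hsn.trans hnm)
  obtain rfl : r = a + b + s := by omega
  refine ⟨?_, ?_, ?_⟩
  · rintro rfl hlt
    have := completelyMonotonicOn_qF hq hq1 hc hc1 a b 0 (Or.inl hlt) (powerSumLE_zero a b)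
    rwa [show 1 + a = a + 0 + 1 by ring, show 1 + b = b + 0 + 1 by ring]
  · rintro rfl
    have := completelyMonotonicOn_qF hq hq1 hc hc1 a b 1 (Or.inr one_pos) (powerSumLE_one a b)
    rwa [show 2 + a = a + 1 + 1 by ring, show 2 + b = b + 1 + 1 by ring]
  · rintro rfl hb
    obtain rfl : b = 1 := by omega
    have := completelyMonotonicOn_qF hq hq1 hc hc1 a 1 2 (Or.inr two_pos) (powerSumLE_two a)
    rwa [show 3 + a = a + 2 + 1 by ring]
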